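/- Relational types have finitely many relation symbols, each of positive arity. For relational structures, an embedding is an injective map that preserves and reflects all relations; "substructure" means induced substructure. A structure is connected if its Gaifman graph (two distinct vertices are adjacent iff they occur together in a tuple of some relation) is connected; a connected structure is nonempty. For a set $\mathcal F$ of structures of a given type, $\mathrm{Forb}_h(\mathcal F)$ (respectively $\mathrm{Forb}_e(\mathcal F)$) is the class of all countable (possibly finite) structures $A$ of that type such that no $F\in\mathcal F$ has a homomorphism (respectively an embedding) into $A$. If the type $\Delta'$ contains the type $\Delta$, the shadow of a $\Delta'$-structure is its $\Delta$-reduct. A class is an amalgamation class if it is closed under taking structures that embed into its members and has the joint embedding property and the amalgamation property with respect to embeddings. A structure $U$ is universal for a class $\mathcal K$ if $U\in\mathcal K$ and every member of $\mathcal K$ embeds into $U$; it is generic for $\mathcal K$ if moreover it is ultrahomogeneous, i.e. every isomorphism between finite substructures of $U$ extends to an automorphism of $U$. The Fraïssé limit of a class $\mathcal K_0$ of finite structures is the countable ultrahomogeneous structure, unique up to isomorphism, such that the finite structures embedding into it are exactly the members of $\mathcal K_0$. **Theorem.** For every finite set $\mathcal F$ of finite connected structures of a relational type $\Delta$ there exist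 a relational type $\Delta'$ containing $\Delta$ and a finite set $\mathcal F'$ of finite $\Delta'$-structures such that: 1. $\mathrm{Forb}_e(\mathcal F')$ is an amalgamation class, its finite members also form an amalgamation class that is nonempty and has only countably many isomorphism types (a Fraïssé class), and the class of shadows of the members of $\mathrm{Forb}_e(\mathcal F')$ is exactly $\mathrm{Forb}_h(\mathcal F)$. 2. The class of finite members of $\mathrm{Forb}_e(\mathcal F')$ has a Fraïssé limit $U'$. This $U'$ is generic for $\mathrm{Forb}_e(\mathcal F')$, and its shadow is a universal structure for $\mathrm{Forb}_h(\mathcal F)$. -/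

import Mathlib

open FirstOrder CategoryTheory

namespace RelStr

/-- `L` is a (finite) type of relational structures: finitely many relation symbols, each of
positive arity, and no function symbols. -/
structure IsFiniteType (L : FirstOrder.Language.{0, 0}) : Prop where
  relational : L.IsRelational
  finite : Finite (Σ n, L.Relations n)
  positive : IsEmpty (L.Relations 0)

/-- The Gaifman graph of a structure: two distinct vertices are adjacent iff they occur together
in a tuple of some relation. -/
def gaifmanGraph (L : FirstOrder.Language.{0, 0}) (A : Type) [L.Structure A] : SimpleGraph A where
  Adj x y := x ≠ y ∧ ∃ (n : ℕ) (R : L.Relations n) (v : Fin n → A),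
    FirstOrder.Language.Structure.RelMap R v ∧ x ∈ Set.range v ∧ y ∈ Set.range v
  symm := ⟨by
    rintro x y ⟨hne, n, R, v, hv, hx, hy⟩
    exact ⟨hne.symm, n, R, v, hv, hy, hx⟩⟩
  loopless := ⟨fun _ h => h.1 rfl⟩

/-- A structure is connected if its Gaifman graph is connected (in particular nonempty). -/
def IsConnected {L : FirstOrder.Language.{0, 0}} (A : Bundled.{0} L.Structure) : Prop :=
  (gaifmanGraph L A).Connected

/-- The class of countable structures admitting no homomorphism from a member of `F`. -/
def ForbH {L : FirstOrder.Language.{0, 0}} (F : Set (Bundled.{0} L.Structure)) :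
    Set (Bundled.{0} L.Structure) :=
  {A | Countable A ∧ ∀ B ∈ F, IsEmpty (B →[L] A)}

/-- The class of countable structures admitting no embedding of a member of `F`
(embeddings are injective and preserve and reflect all relations). -/
def ForbE {L : FirstOrder.Language.{0, 0}} (F : Set (Bundled.{0} L.Structure)) :
    Set (Bundled.{0} L.Structure) :=
  {A | Countable A ∧ ∀ B ∈ F, IsEmpty (B ↪[L] A)}

/-- The finite members of a class of structures. -/
def finitePart {L : FirstOrder.Language.{0, 0}} (K : Set (Bundled.{0} L.Structure)) :
    Set (Bundled.{0} L.Structure) :=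
  {A | A ∈ K ∧ Finite A}

/-- The shadow (reduct) of a structure in the extended type. -/
def shadow {L E : FirstOrder.Language.{0, 0}} (X : Bundled.{0} (L.sum E).Structure) :
    Bundled.{0} L.Structure :=
  ⟨X, (FirstOrder.Language.LHom.sumInl : L →ᴸ L.sum E).reduct X⟩

/-- An amalgamation class: the hereditary property for arbitrary induced substructures, the
joint embedding property, and the amalgamation property. -/
structure IsAmalgamationClass {L : FirstOrder.Language.{0, 0}} (K : Set (Bundled.{0} L.Structure)) :
    Prop where
  hereditary : ∀ A ∈ K, ∀ B : Bundled.{0} L.Structure, Nonempty (B ↪[L] A) → B ∈ K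
  jointEmbedding : FirstOrder.Language.JointEmbedding K
  amalgamation : FirstOrder.Language.Amalgamation K

/-- `U` is an embedding-universal structure for the class `K`. -/
def IsUniversal {L : FirstOrder.Language.{0, 0}} (K : Set (Bundled.{0} L.Structure))
    (U : Bundled.{0} L.Structure) : Prop :=
  U ∈ K ∧ ∀ A ∈ K, Nonempty (A ↪[L] U)

/-- `U` is generic for the class `K`: universal for `K` and ultrahomogeneous. -/
def IsGeneric {L : FirstOrder.Language.{0, 0}} (K : Set (Bundled.{0} L.Structure))
    (U : Bundled.{0} L.Structure) : Prop :=
  IsUniversal K U ∧ L.IsUltrahomogeneous U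

/-- `U` is a Fraïssé limit of the class `K` of finite structures: it is countable,
ultrahomogeneous, and `K` is the class of finite structures that embed into it. -/
def IsLimit {L : FirstOrder.Language.{0, 0}} (K : Set (Bundled.{0} L.Structure))
    (U : Bundled.{0} L.Structure) : Prop :=
  ∃ (_ : Countable (Σ l, L.Functions l)) (_ : Countable U), FirstOrder.Language.IsFraisseLimit K U

end RelStr

/-! Let `n` be a positive bound on the sizes of the members of `F`. Gluing two `F`-free structures
freely over a common part can create a homomorphic image of a member of `F`, split between the two
sides. To prevent this, the lift records, for each rooted structure with at most `n` vertices whose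
roots meet every component (a piece), the tuples to which some homomorphism sends its roots. `canon`
is the lift defined in this way, and `liftClass` consists of the induced substructures of such lifts
of countable `F`-free structures.

Amalgamation: if the lifts of `B` and `C` agree on `M`, the part of a homomorphism lying over `C` is
a piece attached along `M`. Its presence is recorded on `M`, so it can be mapped into `B` instead
without moving its roots (`exists_hom_of_isEmb_canon`, `IsFreeAmalgam.exists_hom_left`). Hence the
free amalgam makes no new piece hold on either side and, members of `F` being connected, contains no
image of them.

Finite description: from a lift, an `F`-free structure can be rebuilt by gluing on a fresh copy of
each piece that holds. A map from at most `n` vertices involves at most `n` such copies or old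
vertices, each with at most `n` roots, so substructures with at most `n * n` vertices decide
membership (`mem_liftClass_of_locallyLift`). Thus `liftClass` is `ForbE` of a finite set, and
Fraïssé theory supplies the limit. -/

namespace RelStr

open FirstOrder.Language

/-! ### Homomorphisms and embeddings with explicit structures -/

section Maps

variable {L : FirstOrder.Language.{0, 0}} {A B C : Type}

/-- A map preserving all relations, with the structures as explicit arguments. -/
def IsHom (sA : L.Structure A) (sB : L.Structure B) (f : A → B) : Prop :=
  ∀ k (R : L.Relations k) (v : Fin k → A), sA.RelMap R v → sB.RelMap R (f ∘ v)

/-- An injective map preserving and reflecting all relations, with the structures as explicit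
arguments. -/
structure IsEmb (sA : L.Structure A) (sB : L.Structure B) (f : A → B) : Prop where
  inj : Function.Injective f
  rel : ∀ k (R : L.Relations k) (v : Fin k → A), sA.RelMap R v ↔ sB.RelMap R (f ∘ v)

/-- The structure on a type over a relational language with prescribed relations. -/
@[reducible]
def ofRel [L.IsRelational] (r : ∀ k, L.Relations k → (Fin k → A) → Prop) : L.Structure A where
  RelMap {k} R v := r k R v

/-- The structure induced on the domain of a map. -/
@[reducible]
def pull [L.IsRelational] (sB : L.Structure B) (f : A → B) : L.Structure A :=
  ofRel fun _ R v => sB.RelMap R (f ∘ v)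

theorem IsEmb.comp {sA : L.Structure A} {sB : L.Structure B} {sC : L.Structure C} {g : B → C}
    {f : A → B} (hg : IsEmb sB sC g) (hf : IsEmb sA sB f) : IsEmb sA sC (g ∘ f) :=
  ⟨hg.inj.comp hf.inj, fun k R v => (hf.rel k R v).trans (hg.rel k R _)⟩

theorem IsEmb.id (sA : L.Structure A) : IsEmb sA sA id :=
  ⟨Function.injective_id, fun _ _ _ => Iff.rfl⟩

/-- An embedding into a larger structure restricts to an embedding into a smaller one. -/
theorem IsEmb.of_comp {sA : L.Structure A} {sB : L.Structure B} {sC : L.Structure C} {g : B → C}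
    {f : A → B} (hg : IsEmb sB sC g) (hf : IsEmb sA sC (g ∘ f)) : IsEmb sA sB f :=
  ⟨hf.inj.of_comp, fun k R v => (hf.rel k R v).trans (hg.rel k R _).symm⟩

theorem isEmb_pull [L.IsRelational] (sB : L.Structure B) {f : A → B} (hf : Function.Injective f) :
    IsEmb (pull sB f) sB f := ⟨hf, fun _ _ _ => Iff.rfl⟩

/-- The inverse of a bijective embedding is an embedding. -/
theorem IsEmb.symm {sA : L.Structure A} {sB : L.Structure B} {e : A ≃ B} (h : IsEmb sA sB e) :
    IsEmb sB sA e.symm :=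
  ⟨e.symm.injective, fun k R v => by
    rw [h.rel]
    simp [← Function.comp_assoc]⟩

theorem isEmb_coe {sA : L.Structure A} {sB : L.Structure B} (f : A ↪[L] B) : IsEmb sA sB f :=
  ⟨f.injective, fun _ R v => (f.map_rel R v).symm⟩

theorem isHom_coe {sA : L.Structure A} {sB : L.Structure B} (f : A →[L] B) : IsHom sA sB f :=
  fun _ R v => f.map_rel R v

/-- The bundled embedding of an embedding. -/
def IsEmb.toEmbedding [L.IsRelational] {sA : L.Structure A} {sB : L.Structure B} {f : A → B}
    (h : IsEmb sA sB f) : A ↪[L] B where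
  toFun := f
  inj' := h.inj
  map_fun' F := isEmptyElim F
  map_rel' R v := (h.rel _ R v).symm

/-- The bundled homomorphism of a homomorphism. -/
def IsHom.toHom [L.IsRelational] {sA : L.Structure A} {sB : L.Structure B} {f : A → B}
    (h : IsHom sA sB f) : A →[L] B where
  toFun := f
  map_fun' F := isEmptyElim F
  map_rel' R v := h _ R v

theorem structure_ext [L.IsRelational] {s t : L.Structure A}
    (h : ∀ k (R : L.Relations k) v, s.RelMap R v ↔ t.RelMap R v) : s = t := by
  refine Structure.ext ?_ ?_
  · funext k F
    exact isEmptyElim F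
  · funext k R v
    exact propext (h k R v)

theorem finite_structure [L.IsRelational] [Finite (Σ k, L.Relations k)] [Finite A] :
    Finite (L.Structure A) := by
  refine Finite.of_injective
    (β := ∀ x : Σ k, L.Relations k, Set (Fin x.1 → A)) (fun s x => {v | s.RelMap x.2 v}) ?_
  intro s t h
  refine structure_ext fun k R v => ?_
  have := congrFun h ⟨k, R⟩
  exact Set.ext_iff.1 this v

/-- With all arities positive there are no tuples to compare, so the empty structure is a common
substructure of everything. -/
theorem isEmb_of_isEmpty [L.IsRelational] (h0 : IsEmpty (L.Relations 0)) [IsEmpty A]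
    (sA : L.Structure A) (sB : L.Structure B) (f : A → B) : IsEmb sA sB f := by
  refine ⟨Function.injective_of_subsingleton f, fun k R v => ?_⟩
  rcases k with _ | k
  · exact h0.elim R
  · exact isEmptyElim (v 0)

end Maps

/-! ### Fraïssé limits of amalgamation classes over a relational language -/

section Limits

variable {L : FirstOrder.Language.{0, 0}} [L.IsRelational]

/-- A partial injection from `ℕ` with finite domain into a finite type extends to an injection of
the whole type, in the opposite direction. -/
theorem exists_injective_extension {A : Type} [Finite A] {s : Finset ℕ} {f : s → A}
    (hf : Function.Injective f) : ∃ g : A → ℕ, Function.Injective g ∧ ∀ x, g (f x) = x := by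
  classical
  -- Labels larger than every element of `s`, for the vertices outside the range of `f`.
  let b : A → ℕ := fun y => s.sup id + 1 + Finite.equivFin A y
  have hb : ∀ y (x : s), (x : ℕ) ≠ b y := fun y x h => by
    have h1 : (x : ℕ) ≤ s.sup id := Finset.le_sup (f := id) x.2
    simp only [b] at h
    omega
  have hbi : Function.Injective b := fun y y' h => by
    have h1 : (Finite.equivFin A y : ℕ) = Finite.equivFin A y' := by
      simp only [b] at h
      omega
    exact (Finite.equivFin A).injective (Fin.ext h1)
  let g : A → ℕ := fun y => if h : ∃ x, f x = y then (h.choose : ℕ) else b y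
  have hg : ∀ x, g (f x) = x := fun x => by
    have h : ∃ x', f x' = f x := ⟨x, rfl⟩
    simp only [g, dif_pos h]
    rw [hf h.choose_spec]
  have hg' : ∀ y, (¬ ∃ x, f x = y) → g y = b y := fun y h => dif_neg h
  refine ⟨g, fun y y' h => ?_, hg⟩
  by_cases hy : ∃ x, f x = y <;> by_cases hy' : ∃ x, f x = y'
  · obtain ⟨x, rfl⟩ := hy
    obtain ⟨x', rfl⟩ := hy'
    rw [hg, hg] at h
    rw [Subtype.ext h]
  · obtain ⟨x, rfl⟩ := hy
    rw [hg, hg' _ hy'] at h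
    exact (hb _ _ h).elim
  · obtain ⟨x', rfl⟩ := hy'
    rw [hg, hg' _ hy] at h
    exact (hb _ _ h.symm).elim
  · rw [hg' _ hy, hg' _ hy'] at h
    exact hbi h

/-- A finite partial approximation, on a set of natural numbers, of a limit of the class `K`. -/
structure Approx (K : Set (Bundled.{0} L.Structure)) where
  dom : Finset ℕ
  str : L.Structure ℕ
  mem : (⟨dom, pull str ((↑) : dom → ℕ)⟩ : Bundled.{0} L.Structure) ∈ K

variable {K : Set (Bundled.{0} L.Structure)}

instance : Preorder (Approx K) where
  le p q := p.dom ⊆ q.dom ∧ ∀ k (R : L.Relations k) (v : Fin k → ℕ), (∀ i, v i ∈ p.dom) →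
    (p.str.RelMap R v ↔ q.str.RelMap R v)
  le_refl p := ⟨Finset.Subset.refl _, fun _ _ _ _ => Iff.rfl⟩
  le_trans p q r h h' := ⟨h.1.trans h'.1, fun k R v hv =>
    (h.2 k R v hv).trans (h'.2 k R v fun i => h.1 (hv i))⟩

/-- The class `K` is closed under finite induced substructures. -/
def ClosedUnderEmb (K : Set (Bundled.{0} L.Structure)) : Prop :=
  ∀ A ∈ K, ∀ (B : Bundled.{0} L.Structure) (f : B → A), IsEmb B.str A.str f → B ∈ K

theorem Approx.exists_le (hK : ClosedUnderEmb K) (p : Approx K) {A : Bundled.{0} L.Structure}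
    (hA : A ∈ K) [Finite A] {f : p.dom → A} (hf : IsEmb (pull p.str ((↑) : p.dom → ℕ)) A.str f) :
    ∃ (q : Approx K) (g : A → ℕ), p ≤ q ∧ IsEmb A.str q.str g ∧ (∀ x, g (f x) = x) ∧
      ∀ y, g y ∈ q.dom := by
  classical
  have := Fintype.ofFinite A
  obtain ⟨g, hg, hgf⟩ := exists_injective_extension hf.inj
  let s : L.Structure ℕ := ofRel fun k R v => ∃ w, A.str.RelMap R w ∧ g ∘ w = v
  have hgs : IsEmb A.str s g := ⟨hg, fun k R v => ⟨fun h => ⟨v, h, rfl⟩, by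
    rintro ⟨w, hw, hwv⟩
    rwa [← hg.comp_left hwv]⟩⟩
  choose σ hσ using fun y : Finset.univ.image g => (Finset.mem_image.1 y.2)
  have hσ' : g ∘ σ = ((↑) : Finset.univ.image g → ℕ) := funext fun y => (hσ y).2
  refine ⟨⟨Finset.univ.image g, s, hK A hA _ σ (hgs.of_comp ?_)⟩, g, ⟨?_, fun k R v hv => ?_⟩,
    hgs, hgf, fun y => Finset.mem_image_of_mem _ (Finset.mem_univ y)⟩
  · rw [hσ']
    exact isEmb_pull s Subtype.val_injective
  · intro x hx
    exact Finset.mem_image.2 ⟨f ⟨x, hx⟩, Finset.mem_univ _, hgf _⟩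
  · have h1 := (hf.rel k R fun i => ⟨v i, hv i⟩).trans (hgs.rel k R _)
    have h2 : g ∘ (f ∘ fun i => ⟨v i, hv i⟩) = v := funext fun i => hgf _
    rwa [h2] at h1

/-- The map `a` embeds the structure into the approximation. -/
def Approx.Fits (p : Approx K) {m : ℕ} (s : L.Structure (Fin m)) (a : Fin m → ℕ) : Prop :=
  (∀ i, a i ∈ p.dom) ∧ IsEmb s p.str a

theorem Approx.Fits.mono {p q : Approx K} (hpq : p ≤ q) {m : ℕ} {s : L.Structure (Fin m)}
    {a : Fin m → ℕ} (h : p.Fits s a) : q.Fits s a :=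
  ⟨fun i => hpq.1 (h.1 i), h.2.inj, fun k R v =>
    (h.2.rel k R v).trans (hpq.2 k R _ fun i => h.1 (v i))⟩

/-- Amalgamate the approximation with the one-point extension over their common base, then label the
amalgam by natural numbers, keeping the old labels. -/
theorem Approx.exists_fits_snoc (hK : ClosedUnderEmb K) (hfin : ∀ A ∈ K, Finite A)
    (ham : Amalgamation K) (p : Approx K) {m : ℕ} {s : L.Structure (Fin (m + 1))}
    (hs : (⟨Fin (m + 1), s⟩ : Bundled.{0} L.Structure) ∈ K) {a : Fin m → ℕ}
    (h : p.Fits (pull s Fin.castSucc) a) : ∃ q, p ≤ q ∧ ∃ b, q.Fits s (Fin.snoc a b) := by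
  have h1 : IsEmb (pull s Fin.castSucc) s (Fin.castSucc : Fin m → Fin (m + 1)) :=
    isEmb_pull s (Fin.castSucc_injective m)
  have h2 : IsEmb (pull s Fin.castSucc) (pull p.str ((↑) : p.dom → ℕ))
      (fun i => (⟨a i, h.1 i⟩ : p.dom)) :=
    (isEmb_pull p.str Subtype.val_injective).of_comp h.2
  obtain ⟨A, u, w, hA, hcomm⟩ := ham ⟨Fin m, pull s Fin.castSucc⟩ ⟨p.dom, pull p.str _⟩
    ⟨Fin (m + 1), s⟩ h2.toEmbedding h1.toEmbedding (hK _ hs _ _ h1) p.mem hs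
  have := hfin A hA
  obtain ⟨q, g, hpq, hg, hgu, hgd⟩ := p.exists_le hK hA (isEmb_coe u)
  refine ⟨q, hpq, g (w (Fin.last m)), ?_⟩
  have h3 : (Fin.snoc a (g (w (Fin.last m))) : Fin (m + 1) → ℕ) = g ∘ w := by
    funext i
    refine Fin.lastCases ?_ (fun j => ?_) i
    · simp
    · rw [Fin.snoc_castSucc]
      have h4 : u ⟨a j, h.1 j⟩ = w (Fin.castSucc j) := DFunLike.congr_fun hcomm j
      rw [Function.comp_apply, ← h4, hgu]
  rw [h3]
  exact ⟨fun i => hgd _, hg.comp (isEmb_coe w)⟩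

/-- The approximations that have settled a one-point extension problem. -/
def settled (hK : ClosedUnderEmb K) (hfin : ∀ A ∈ K, Finite A) (ham : Amalgamation K)
    (x : Σ m, L.Structure (Fin (m + 1)) × (Fin m → ℕ)) : Order.Cofinal (Approx K) where
  carrier := {p | (⟨_, x.2.1⟩ : Bundled.{0} L.Structure) ∈ K →
    (∃ q, p ≤ q ∧ q.Fits (pull x.2.1 Fin.castSucc) x.2.2) →
    ∃ b, p.Fits x.2.1 (Fin.snoc x.2.2 b)}
  isCofinal p := by
    by_cases hx : (⟨_, x.2.1⟩ : Bundled.{0} L.Structure) ∈ K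
    -- Either some extension realises the base, and amalgamation solves the problem above it, or
    -- none does, and `p` is settled vacuously.
    · by_cases hp : ∃ q, p ≤ q ∧ q.Fits (pull x.2.1 Fin.castSucc) x.2.2
      · obtain ⟨q, hpq, hq⟩ := hp
        obtain ⟨r, hqr, hr⟩ := q.exists_fits_snoc hK hfin ham hx hq
        exact ⟨r, fun _ _ => hr, hpq.trans hqr⟩
      · exact ⟨p, fun _ h => (hp h).elim, le_rfl⟩
    · exact ⟨p, fun h => (hx h).elim, le_rfl⟩

/-- An amalgamation class of finite structures has a countable structure with the one-point
extension property all of whose finite substructures are in the class. -/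
theorem exists_extension_structure [Finite (Σ k, L.Relations k)] (h0 : IsEmpty (L.Relations 0))
    (hK : ClosedUnderEmb K) (hfin : ∀ A ∈ K, Finite A) (ham : Amalgamation K)
    (hne : K.Nonempty) :
    ∃ (U : Type) (sU : L.Structure U), Countable U ∧
      (∀ A : Bundled.{0} L.Structure, Finite A → ∀ f : A → U, IsEmb A.str sU f → A ∈ K) ∧
      ∀ (m : ℕ) (s : L.Structure (Fin (m + 1))), (⟨_, s⟩ : Bundled.{0} L.Structure) ∈ K →
        ∀ a : Fin m → U, IsEmb (pull s Fin.castSucc) sU a →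
          ∃ b, IsEmb s sU (Fin.snoc a b : Fin (m + 1) → U) := by
  obtain ⟨A₀, hA₀⟩ := hne
  have : ∀ m, Finite (L.Structure (Fin (m + 1))) := fun m => finite_structure
  have : Encodable (Σ m, L.Structure (Fin (m + 1)) × (Fin m → ℕ)) := Encodable.ofCountable _
  let p₀ : Approx K := ⟨∅, ofRel fun _ _ _ => False,
    hK A₀ hA₀ _ (fun x => absurd x.2 (Finset.notMem_empty _)) (isEmb_of_isEmpty h0 _ _ _)⟩
  -- There are only countably many extension problems, so one ideal meets all the cofinal sets
  -- `settled`; its union is the required structure.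
  let G := Order.idealOfCofinals p₀ (settled hK hfin ham)
  have : Nonempty {p // p ∈ G} := ⟨⟨p₀, Order.mem_idealOfCofinals _ _⟩⟩
  have : IsDirectedOrder {p // p ∈ G} := ⟨fun p q => by
    obtain ⟨r, hr, hpr, hqr⟩ := G.directed p p.2 q q.2
    exact ⟨⟨r, hr⟩, hpr, hqr⟩⟩
  let U := {x : ℕ // ∃ p ∈ G, x ∈ p.dom}
  let sU : L.Structure U := ofRel fun k R v => ∃ p ∈ G, (∀ i, (v i).1 ∈ p.dom) ∧
    p.str.RelMap R (Subtype.val ∘ v)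
  have hrel : ∀ p ∈ G, ∀ k (R : L.Relations k) (v : Fin k → U), (∀ i, (v i).1 ∈ p.dom) →
      (sU.RelMap R v ↔ p.str.RelMap R (Subtype.val ∘ v)) := by
    intro p hp k R v hv
    refine ⟨?_, fun h => ⟨p, hp, hv, h⟩⟩
    rintro ⟨q, hq, hqv, h⟩
    obtain ⟨r, hr, hpr, hqr⟩ := G.directed p hp q hq
    exact (hpr.2 k R _ hv).2 ((hqr.2 k R _ hqv).1 h)
  have hcov : ∀ {ι : Type} [Finite ι] (v : ι → U), ∃ p ∈ G, ∀ i, (v i).1 ∈ p.dom := by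
    intro ι _ v
    choose p hp hpv using fun i => (v i).2
    obtain ⟨q, hq⟩ := Finite.exists_le fun i => (⟨p i, hp i⟩ : {p // p ∈ G})
    exact ⟨q, q.2, fun i => (hq i).1 (hpv i)⟩
  refine ⟨U, sU, inferInstance, ?_, ?_⟩
  · intro A hA f hf
    obtain ⟨p, hp, hpf⟩ := hcov f
    refine hK _ p.mem A (fun x => ⟨f x, hpf x⟩) ⟨fun x y h => hf.inj (Subtype.ext (Subtype.mk.inj h)),
      ?_⟩
    exact fun k R v => (hf.rel k R v).trans (hrel p hp k R _ fun i => hpf _)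
  · intro m s hs a ha
    obtain ⟨p, hpD, hp⟩ := Order.cofinal_meets_idealOfCofinals p₀ (settled hK hfin ham)
      ⟨m, s, Subtype.val ∘ a⟩
    obtain ⟨q, hq, hqa⟩ := hcov a
    -- The settled `p` need not contain `a`; it is enough that some `r` above it does, and the new
    -- point is then already in `p`.
    obtain ⟨r, hr, hpr, hqr⟩ := G.directed p hp q hq
    have hra : ∀ i, (a i).1 ∈ r.dom := fun i => hqr.1 (hqa i)
    obtain ⟨b, hb⟩ := hpD hs ⟨r, hpr, hra, Subtype.val_injective.comp ha.inj, fun k R v =>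
      (ha.rel k R v).trans (hrel r hr k R _ fun i => hra _)⟩
    have hbp : b ∈ p.dom := by simpa using hb.1 (Fin.last m)
    let b' : U := ⟨b, p, hp, hbp⟩
    have h1 : Subtype.val ∘ (Fin.snoc a b' : Fin (m + 1) → U) =
        (Fin.snoc (Subtype.val ∘ a) b : Fin (m + 1) → ℕ) := Fin.comp_snoc _ _ _
    have h2 := hb.1
    have h3 := hb.2
    dsimp only at h2 h3
    rw [← h1] at h2 h3
    exact ⟨b', h3.inj.of_comp, fun k R v =>
      (h3.rel k R v).trans (hrel p hp k R _ fun i => h2 (v i)).symm⟩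

/-- A countable structure with the one-point extension property for finite structures that embed
into it is ultrahomogeneous. -/
theorem isUltrahomogeneous_of_extension {U : Type} [sU : L.Structure U] [Countable U]
    (hext : ∀ (m : ℕ) (u : Fin (m + 1) → U), Function.Injective u → ∀ a : Fin m → U,
      IsEmb (pull sU (u ∘ Fin.castSucc)) sU a →
        ∃ b, IsEmb (pull sU u) sU (Fin.snoc a b : Fin (m + 1) → U)) :
    L.IsUltrahomogeneous U := by
  rw [isUltrahomogeneous_iff_IsExtensionPair Structure.cg_of_countable,
    isExtensionPair_iff_exists_embedding_closure_singleton_sup]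
  intro S hS f x
  have := Substructure.FG.finite hS
  by_cases hx : x ∈ S
  · have hle : Substructure.closure L {x} ⊔ S ≤ S :=
      sup_le (Substructure.closure_le.2 (Set.singleton_subset_iff.2 hx)) le_rfl
    exact ⟨f.comp (Substructure.inclusion hle), DFunLike.ext _ _ fun y => rfl⟩
  let u : S ≃ Fin (Nat.card S) := Finite.equivFin S
  let u' : Fin (Nat.card S + 1) → U := Fin.snoc (fun i => (u.symm i : U)) x
  have hu'c : ∀ j, u' (Fin.castSucc j) = u.symm j := fun j => Fin.snoc_castSucc ..
  have hu'l : u' (Fin.last _) = x := Fin.snoc_last ..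
  have hu' : Function.Injective u' := by
    rw [Fin.snoc_injective_iff]
    refine ⟨Subtype.val_injective.comp u.symm.injective, ?_⟩
    rintro ⟨i, rfl⟩
    exact hx (u.symm i).2
  obtain ⟨b, hb⟩ := hext _ u' hu' (f ∘ u.symm) ⟨f.injective.comp u.symm.injective,
    fun k R v => by
      have h1 := (isEmb_coe f).rel k R (u.symm ∘ v)
      rw [← Function.comp_assoc] at h1
      rw [← h1]
      change sU.RelMap R ((u' ∘ Fin.castSucc) ∘ v) ↔ sU.RelMap R (Subtype.val ∘ u.symm ∘ v)
      rw [show u' ∘ Fin.castSucc = Subtype.val ∘ u.symm from funext hu'c, Function.comp_assoc]⟩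
  have hmem : ∀ i, u' i ∈ Substructure.closure L {x} ⊔ S := by
    refine Fin.lastCases ?_ fun j => ?_
    · rw [hu'l]
      exact (le_sup_left : _ ≤ Substructure.closure L {x} ⊔ S)
        (Substructure.subset_closure (Set.mem_singleton x))
    · rw [hu'c]
      exact (le_sup_right : _ ≤ Substructure.closure L {x} ⊔ S) (u.symm j).2
  -- In a relational language the substructure generated by `S` and `x` is just `S ∪ {x}`, which
  -- `u'` enumerates.
  let e : Fin (Nat.card S + 1) ≃ ↥(Substructure.closure L {x} ⊔ S) := by
    refine Equiv.ofBijective (fun i => ⟨u' i, hmem i⟩)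
      ⟨fun i j h => hu' (congrArg Subtype.val h), ?_⟩
    rintro ⟨y, hy⟩
    have hy' : y ∈ Substructure.closure L (insert x (S : Set U)) := by
      rwa [Set.insert_eq, Substructure.closure_union, Substructure.closure_eq]
    rw [Substructure.mem_closure_iff_of_isRelational] at hy'
    rcases hy' with rfl | hy'
    · exact ⟨Fin.last _, Subtype.ext hu'l⟩
    · exact ⟨Fin.castSucc (u ⟨y, hy'⟩), Subtype.ext (by simp [hu'c])⟩
  have he : IsEmb (pull sU u') (inferInstance : L.Structure _) e :=
    (isEmb_coe (Substructure.closure L {x} ⊔ S).subtype).of_comp (isEmb_pull sU hu')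
  refine ⟨(hb.comp he.symm).toEmbedding, DFunLike.ext _ _ fun y => ?_⟩
  have h1 : Substructure.inclusion (le_sup_right : S ≤ Substructure.closure L {x} ⊔ S) y =
      e (Fin.castSucc (u y)) := Subtype.ext (by
    change (y : U) = u' _
    rw [hu'c, u.symm_apply_apply])
  rw [Embedding.comp_apply, h1]
  change _ = (Fin.snoc (f ∘ u.symm) b : Fin (Nat.card S + 1) → U) (e.symm (e _))
  rw [e.symm_apply_apply, Fin.snoc_castSucc, Function.comp_apply, u.symm_apply_apply]

/-- The extension property yields ultrahomogeneity, and, starting from the empty structure and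
adding one point at a time, it embeds every member of `K`. -/
theorem exists_isLimit [Finite (Σ k, L.Relations k)] (h0 : IsEmpty (L.Relations 0))
    (hK : ClosedUnderEmb K) (hfin : ∀ A ∈ K, Finite A) (ham : Amalgamation K)
    (hne : K.Nonempty) : ∃ U, IsLimit K U := by
  obtain ⟨U, sU, hU, hage, hext⟩ := exists_extension_structure h0 hK hfin ham hne
  have hfun : IsEmpty (Σ l, L.Functions l) := ⟨fun x => isEmptyElim x.2⟩
  refine ⟨⟨U, sU⟩, inferInstance, hU, ?_, ?_⟩
  · refine isUltrahomogeneous_of_extension fun m u hu a ha => ?_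
    exact hext m (pull sU u) (hage ⟨_, pull sU u⟩ inferInstance u (isEmb_pull sU hu)) a ha
  · have hemb : ∀ m (s : L.Structure (Fin m)), (⟨_, s⟩ : Bundled.{0} L.Structure) ∈ K →
        ∃ a : Fin m → U, IsEmb s sU a := by
      intro m
      induction m with
      | zero => exact fun s _ => ⟨Fin.elim0, isEmb_of_isEmpty h0 _ _ _⟩
      | succ m ih =>
        intro s hs
        obtain ⟨a, ha⟩ := ih (pull s Fin.castSucc)
          (hK _ hs _ Fin.castSucc (isEmb_pull s (Fin.castSucc_injective m)))
        obtain ⟨b, hb⟩ := hext m s hs a ha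
        exact ⟨_, hb⟩
    ext A
    constructor
    · rintro ⟨hA, ⟨f⟩⟩
      exact hage A hA.finite f (isEmb_coe f)
    · intro hA
      have := hfin A hA
      refine ⟨Structure.FG.of_finite, ?_⟩
      let e := (Finite.equivFin A).symm
      have he : IsEmb (pull A.str e) A.str e := isEmb_pull A.str e.injective
      obtain ⟨a, ha⟩ := hemb _ (pull A.str e) (hK A hA _ e he)
      exact ⟨(ha.comp he.symm).toEmbedding⟩

/-- A Fraïssé limit of the finite members of a hereditary class is universal for its countable
members. -/
theorem nonempty_embedding_of_isLimit (h0 : IsEmpty (L.Relations 0)) (hK : ClosedUnderEmb K)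
    {U : Bundled.{0} L.Structure} (hU : IsLimit (finitePart K) U) {A : Bundled.{0} L.Structure}
    (hA : A ∈ K) [Countable A] : Nonempty (A ↪[L] U) := by
  obtain ⟨hfun, hcU, hU⟩ := hU
  have : IsEmpty L.Constants := inferInstanceAs (IsEmpty (L.Functions 0))
  have hpair : L.IsExtensionPair A U := by
    rw [isExtensionPair_iff_exists_embedding_closure_singleton_sup]
    intro S hS f x
    have hfg : (Substructure.closure L {x} ⊔ S).FG :=
      (Substructure.fg_closure_singleton x).sup hS
    have hT : (⟨↥(Substructure.closure L {x} ⊔ S), inferInstance⟩ : Bundled.{0} L.Structure) ∈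
        L.age U := by
      rw [hU.age]
      exact ⟨hK A hA _ _ (isEmb_coe (Substructure.closure L {x} ⊔ S).subtype), hfg.finite⟩
    have := hT.2
    -- Finite substructures of `A` lie in the age of `U`, so ultrahomogeneity extends `f` by one
    -- point. Going forth through the countable `A` is enough.
    exact hU.ultrahomogeneous.extend_embedding (S.fg_iff_structure_fg.1 hS) f
      (Substructure.inclusion le_sup_right)
  obtain ⟨f, -⟩ := embedding_from_cg Structure.cg_of_countable default hpair
  exact ⟨f⟩

/-- Amalgamate over the empty structure. -/
theorem jointEmbedding_of_amalgamation (h0 : IsEmpty (L.Relations 0)) (hK : ClosedUnderEmb K)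
    (ham : Amalgamation K) : JointEmbedding K := by
  intro A hA B hB
  let s : L.Structure Empty := ofRel fun _ _ _ => False
  have hs : ∀ C : Bundled.{0} L.Structure, IsEmb s C.str (Empty.elim : Empty → C) :=
    fun C => isEmb_of_isEmpty h0 _ _ _
  obtain ⟨D, u, v, hD, -⟩ := ham ⟨Empty, s⟩ A B (hs A).toEmbedding (hs B).toEmbedding
    (hK A hA _ _ (hs A)) hA hB
  exact ⟨D, hD, ⟨u⟩, ⟨v⟩⟩

/-- The union of the two images inside any amalgam is a finite amalgam. -/
theorem amalgamation_finitePart (hK : ClosedUnderEmb K) (ham : Amalgamation K) :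
    Amalgamation (finitePart K) := by
  rintro A B C u v ⟨hA, hAf⟩ ⟨hB, hBf⟩ ⟨hC, hCf⟩
  obtain ⟨D, u', v', hD, hcomm⟩ := ham A B C u v hA hB hC
  let S : Set D := Set.range u' ∪ Set.range v'
  have hS : Finite S := ((Set.finite_range u').union (Set.finite_range v')).to_subtype
  have hS' : IsEmb (pull D.str ((↑) : S → D)) D.str ((↑) : S → D) :=
    isEmb_pull D.str Subtype.val_injective
  have hu : IsEmb B.str (pull D.str ((↑) : S → D)) fun b => ⟨u' b, Or.inl ⟨b, rfl⟩⟩ :=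
    hS'.of_comp (isEmb_coe u')
  have hv : IsEmb C.str (pull D.str ((↑) : S → D)) fun c => ⟨v' c, Or.inr ⟨c, rfl⟩⟩ :=
    hS'.of_comp (isEmb_coe v')
  exact ⟨⟨S, pull D.str _⟩, hu.toEmbedding, hv.toEmbedding, ⟨hK D hD _ _ hS', hS⟩,
    DFunLike.ext _ _ fun x => Subtype.ext (DFunLike.congr_fun hcomm x)⟩

end Limits

/-- A forbidden structure embedding into `U` is finite, hence in the age, hence in `ForbE F`; but it
embeds into itself. -/
theorem mem_forbE_of_isLimit {L : FirstOrder.Language.{0, 0}} {F : Set (Bundled.{0} L.Structure)}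
    (hfin : ∀ X ∈ F, Finite X) {U : Bundled.{0} L.Structure}
    (hU : IsLimit (finitePart (ForbE F)) U) : U ∈ ForbE F := by
  obtain ⟨hfun, hcU, hU⟩ := hU
  refine ⟨hcU, fun X hX => ⟨fun f => ?_⟩⟩
  have := hfin X hX
  have h1 : X ∈ L.age U := ⟨Structure.FG.of_finite, ⟨f⟩⟩
  rw [hU.age] at h1
  exact (h1.1.2 X hX).elim (Embedding.refl L X)

/-! ### Rooted pieces and the language naming them -/

section Pieces

variable {L : FirstOrder.Language.{0, 0}} {A B C D M Q : Type}

/-- A set of vertices containing every tuple that meets it. -/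
def ClosedIn (sA : L.Structure A) (T : Set A) : Prop :=
  ∀ k (R : L.Relations k) (v : Fin k → A), sA.RelMap R v → ∀ i j, v i ∈ T → v j ∈ T

/-- A set of vertices that meets every component. -/
def Anchored (sA : L.Structure A) (S : Set A) : Prop :=
  ∀ T : Set A, T.Nonempty → ClosedIn sA T → (T ∩ S).Nonempty

theorem Anchored.mono {sA : L.Structure A} {S S' : Set A} (h : Anchored sA S) (hS : S ⊆ S') :
    Anchored sA S' :=
  fun T hT hc => (h T hT hc).mono (Set.inter_subset_inter_right _ hS)

/-- A walk in the Gaifman graph cannot leave a closed set, so a nonempty closed set is everything.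
-/
theorem anchored_of_isConnected {A : Bundled.{0} L.Structure} (h : IsConnected A) {S : Set A}
    (hS : S.Nonempty) : Anchored A.str S := by
  rintro T ⟨t, ht⟩ hc
  obtain ⟨s, hs⟩ := hS
  have h1 := (SimpleGraph.reachable_iff_reflTransGen t s).1 (h.preconnected t s)
  refine ⟨s, ?_, hs⟩
  clear hs
  induction h1 with
  | refl => exact ht
  | tail _ h2 ih =>
    obtain ⟨-, k, R, v, hv, ⟨i, rfl⟩, ⟨j, rfl⟩⟩ := h2
    exact hc k R v hv i j ih

variable (L) in
/-- The relation symbols of arity `k` naming rooted structures with at most `n` vertices and `k`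
roots that meet every component. -/
structure PieceRel (n k : ℕ) where
  size : Fin (n + 1)
  str : L.Structure (Fin size)
  root : Fin k → Fin size
  pos : 0 < k
  inj : Function.Injective root
  anchored : Anchored str (Set.range root)

variable (L) in
/-- The relational language of the rooted structures with at most `n` vertices. -/
def pieceLang (n : ℕ) : FirstOrder.Language.{0, 0} := ⟨fun _ => Empty, PieceRel L n⟩

instance (n : ℕ) : (pieceLang L n).IsRelational := fun _ => inferInstanceAs (IsEmpty Empty)

theorem PieceRel.arity_le {n k : ℕ} (P : PieceRel L n k) : k ≤ n := by
  have h1 := Fintype.card_le_of_injective _ P.inj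
  have h2 := P.size.2
  simp only [Fintype.card_fin] at h1
  omega

theorem isFiniteType_pieceLang (hL : IsFiniteType L) (n : ℕ) : IsFiniteType (pieceLang L n) := by
  have := hL.relational
  have := hL.finite
  refine ⟨inferInstance, ?_, ⟨fun P : PieceRel L n 0 => absurd P.pos (lt_irrefl _)⟩⟩
  have hfin : ∀ k, Finite (PieceRel L n k) := fun k => by
    have : ∀ m : Fin (n + 1), Finite (L.Structure (Fin m)) := fun m => finite_structure
    refine Finite.of_injective
      (β := Σ m : Fin (n + 1), L.Structure (Fin m) × (Fin k → Fin m))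
      (fun P => ⟨P.size, P.str, P.root⟩) ?_
    rintro ⟨⟩ ⟨⟩ h
    simp only [Sigma.mk.injEq] at h
    obtain ⟨rfl, h⟩ := h
    simp only [heq_eq_eq, Prod.mk.injEq] at h
    obtain ⟨rfl, rfl⟩ := h
    rfl
  refine Finite.of_injective (β := Σ k : Fin (n + 1), PieceRel L n k)
    (fun x => ⟨⟨x.1, Nat.lt_succ_of_le (PieceRel.arity_le x.2)⟩, x.2⟩) ?_
  rintro ⟨k, P⟩ ⟨k', P'⟩ h
  cases h
  rfl

/-! ### Canonical lifts and free amalgams -/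

/-- `D` is the free amalgam of `B` and `C` over `M`. -/
structure IsFreeAmalgam (sB : L.Structure B) (sC : L.Structure C) (sD : L.Structure D)
    (jB : M → B) (jC : M → C) (iB : B → D) (iC : C → D) : Prop where
  comm : ∀ m, iB (jB m) = iC (jC m)
  meet : ∀ b c, iB b = iC c → ∃ m, b = jB m ∧ c = jC m
  injB : Function.Injective iB
  injC : Function.Injective iC
  cover : ∀ d, (∃ b, iB b = d) ∨ ∃ c, iC c = d
  rel : ∀ k (R : L.Relations k) v, sD.RelMap R v ↔
    (∃ w, sB.RelMap R w ∧ iB ∘ w = v) ∨ ∃ w, sC.RelMap R w ∧ iC ∘ w = v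

theorem IsFreeAmalgam.symm {sB : L.Structure B} {sC : L.Structure C} {sD : L.Structure D}
    {jB : M → B} {jC : M → C} {iB : B → D} {iC : C → D}
    (h : IsFreeAmalgam sB sC sD jB jC iB iC) : IsFreeAmalgam sC sB sD jC jB iC iB where
  comm m := (h.comm m).symm
  meet c b hcb := (h.meet b c hcb.symm).imp fun _ => And.symm
  injB := h.injC
  injC := h.injB
  cover d := (h.cover d).symm
  rel k R v := (h.rel k R v).trans or_comm

variable [L.IsRelational]

/-- The canonical lift: a rooted structure `P` holds at a tuple iff some homomorphism from `P`
maps the roots to that tuple. -/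
@[reducible]
def canon (n : ℕ) (sB : L.Structure B) : (L.sum (pieceLang L n)).Structure B :=
  ofRel fun k R v => Sum.elim (fun R : L.Relations k => sB.RelMap R v)
    (fun P : PieceRel L n k => ∃ h : Fin P.size → B, IsHom P.str sB h ∧ h ∘ P.root = v) R

theorem isEmb_canon_iff {n : ℕ} {sX : (L.sum (pieceLang L n)).Structure A} {sB : L.Structure B}
    {e : A → B} : IsEmb sX (canon n sB) e ↔ Function.Injective e ∧
      (∀ k (R : L.Relations k) v, sX.RelMap (Sum.inl R : L.Relations k ⊕ _) v ↔
        sB.RelMap R (e ∘ v)) ∧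
      (∀ k (P : PieceRel L n k) v, sX.RelMap (Sum.inr P : _ ⊕ (pieceLang L n).Relations k) v ↔
        ∃ h : Fin P.size → B, IsHom P.str sB h ∧ h ∘ P.root = e ∘ v) := by
  constructor
  · intro h
    exact ⟨h.inj, fun k R v => h.rel k (Sum.inl R) v, fun k P v => h.rel k (Sum.inr P) v⟩
  · rintro ⟨h1, h2, h3⟩
    refine ⟨h1, fun k R v => ?_⟩
    rcases R with R | P
    · exact h2 k R v
    · exact h3 k P v

/-- Homomorphisms from an anchored rooted structure can be exchanged between two structures whose
canonical lifts share a common substructure containing the roots. -/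
theorem exists_hom_of_isEmb_canon {n : ℕ} {sM : (L.sum (pieceLang L n)).Structure M}
    {sB : L.Structure B} {sC : L.Structure C} {jB : M → B} {jC : M → C}
    (hB : IsEmb sM (canon n sB) jB) (hC : IsEmb sM (canon n sC) jC)
    [Finite Q] (hQ : Nat.card Q ≤ n) {sQ : L.Structure Q} {S : Set Q} (hS : Anchored sQ S)
    {f : Q → C} (hf : IsHom sQ sC f) (a : S → M) (ha : ∀ q : S, f q = jC (a q)) :
    ∃ g : Q → B, IsHom sQ sB g ∧ ∀ q : S, g q = jB (a q) := by
  -- Pieces have at least one root, so empty `S` is separate: anchoring forces `Q` to be empty,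
  -- leaving only nullary relations, on which both sides agree through `sM`.
  rcases S.eq_empty_or_nonempty with rfl | hne
  · have hQe : IsEmpty Q := by
      by_contra hne
      rw [not_isEmpty_iff] at hne
      obtain ⟨x, -, hx⟩ := hS Set.univ Set.univ_nonempty (fun _ _ _ _ _ _ _ => trivial)
      exact hx
    refine ⟨fun q => hQe.elim q, fun k R v hv => ?_, fun q => hQe.elim q⟩
    have h1 := hf k R v hv
    rcases k with _ | k
    · rw [Subsingleton.elim (f ∘ v) (jC ∘ Fin.elim0)] at h1
      rw [Subsingleton.elim (_ ∘ v) (jB ∘ Fin.elim0)]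
      exact (hB.rel 0 (Sum.inl R) Fin.elim0).1 ((hC.rel 0 (Sum.inl R) Fin.elim0).2 h1)
    · exact hQe.elim (v 0)
  have := hne.to_subtype
  let eQ : Q ≃ Fin (Nat.card Q) := Finite.equivFin Q
  let eS : S ≃ Fin (Nat.card S) := Finite.equivFin S
  -- The piece is `Q` rooted at `S`; the bound `hQ` makes it a symbol of the language.
  let P : PieceRel L n (Nat.card S) :=
    { size := ⟨Nat.card Q, Nat.lt_succ_of_le hQ⟩
      str := pull sQ eQ.symm
      root := fun i => eQ (eS.symm i)
      pos := Nat.card_pos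
      inj := eQ.injective.comp (Subtype.val_injective.comp eS.symm.injective)
      anchored := by
        intro T hT hc
        obtain ⟨q, hq, hqS⟩ := hS (eQ ⁻¹' T) (by
          obtain ⟨t, ht⟩ := hT
          exact ⟨eQ.symm t, by simpa using ht⟩) (by
          intro k R v hv i j hi
          refine hc k R (eQ ∘ v) ?_ i j hi
          change sQ.RelMap R _
          simpa [← Function.comp_assoc] using hv)
        exact ⟨eQ q, hq, eS ⟨q, hqS⟩, congrArg (fun x : S => eQ x) (eS.symm_apply_apply _)⟩ }
  -- `f` witnesses `P` in the lift of `C`, so `P` holds in `M`, and therefore in the lift of `B`.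
  have h1 := ((isEmb_canon_iff.1 hC).2.2 _ P (fun i => a (eS.symm i))).2
    ⟨f ∘ eQ.symm, fun k R v hv => hf k R _ hv, by
      funext i
      exact (congrArg f (eQ.symm_apply_apply _)).trans (ha _)⟩
  obtain ⟨g, hg, hgr⟩ := ((isEmb_canon_iff.1 hB).2.2 _ P _).1 h1
  refine ⟨g ∘ eQ, fun k R v hv => hg k R (eQ ∘ v) ?_, fun q => ?_⟩
  · change sQ.RelMap R _
    simpa [← Function.comp_assoc] using hv
  · have h2 : g (eQ (eS.symm (eS q))) = jB (a (eS.symm (eS q))) := congrFun hgr (eS q)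
    rwa [eS.symm_apply_apply] at h2

theorem exists_isFreeAmalgam (sB : L.Structure B) (sC : L.Structure C) {jB : M → B} {jC : M → C}
    [Countable B] [Countable C]
    (hB : Function.Injective jB) (hC : Function.Injective jC) :
    ∃ (D : Type) (sD : L.Structure D) (iB : B → D) (iC : C → D), Countable D ∧
      IsFreeAmalgam sB sC sD jB jC iB iC := by
  classical
  let iB : B → B ⊕ {c : C // ¬ ∃ m, jC m = c} := Sum.inl
  let iC : C → B ⊕ {c : C // ¬ ∃ m, jC m = c} := fun c =>
    if h : ∃ m, jC m = c then Sum.inl (jB h.choose) else Sum.inr ⟨c, h⟩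
  have hiC : ∀ m, iC (jC m) = Sum.inl (jB m) := fun m => by
    have h : ∃ m', jC m' = jC m := ⟨m, rfl⟩
    simp only [iC, dif_pos h]
    rw [hC h.choose_spec]
  have hiC' : ∀ c (h : ¬ ∃ m, jC m = c), iC c = Sum.inr ⟨c, h⟩ := fun c h => dif_neg h
  refine ⟨_, ofRel fun k R v => (∃ w, sB.RelMap R w ∧ iB ∘ w = v) ∨
    ∃ w, sC.RelMap R w ∧ iC ∘ w = v, iB, iC, inferInstance, ?_, ?_, Sum.inl_injective, ?_, ?_,
    fun _ _ _ => Iff.rfl⟩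
  · exact fun m => (hiC m).symm
  · intro b c h
    by_cases hc : ∃ m, jC m = c
    · obtain ⟨m, rfl⟩ := hc
      rw [hiC] at h
      exact ⟨m, Sum.inl_injective h, rfl⟩
    · rw [hiC' c hc] at h
      cases h
  · intro c c' h
    by_cases hc : ∃ m, jC m = c <;> by_cases hc' : ∃ m, jC m = c'
    · obtain ⟨m, rfl⟩ := hc
      obtain ⟨m', rfl⟩ := hc'
      rw [hiC, hiC] at h
      rw [hB (Sum.inl_injective h)]
    · obtain ⟨m, rfl⟩ := hc
      rw [hiC, hiC' _ hc'] at h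
      cases h
    · obtain ⟨m', rfl⟩ := hc'
      rw [hiC, hiC' _ hc] at h
      cases h
    · rw [hiC' _ hc, hiC' _ hc'] at h
      simpa using h
  · rintro (b | ⟨c, hc⟩)
    · exact Or.inl ⟨b, rfl⟩
    · exact Or.inr ⟨c, hiC' c hc⟩

section Amalgam

variable {n : ℕ} {sM : (L.sum (pieceLang L n)).Structure M} {sB : L.Structure B}
  {sC : L.Structure C} {sD : L.Structure D} {jB : M → B} {jC : M → C} {iB : B → D} {iC : C → D}

/-- A tuple of `C` lying inside `B` lies in `M`, where both lifts carry the same relations. -/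
theorem IsFreeAmalgam.rel_left (hB : IsEmb sM (canon n sB) jB) (hC : IsEmb sM (canon n sC) jC)
    (h : IsFreeAmalgam sB sC sD jB jC iB iC) {k : ℕ} (R : L.Relations k) (v : Fin k → B) :
    sD.RelMap R (iB ∘ v) ↔ sB.RelMap R v := by
  rw [h.rel]
  constructor
  · rintro (⟨w, hw, hwv⟩ | ⟨w, hw, hwv⟩)
    · rwa [← h.injB.comp_left hwv]
    · choose m hm hm' using fun i => h.meet (v i) (w i) (congrFun hwv i).symm
      obtain rfl : v = jB ∘ m := funext hm
      obtain rfl : w = jC ∘ m := funext hm'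
      exact (hB.rel k (Sum.inl R) m).1 ((hC.rel k (Sum.inl R) m).2 hw)
  · exact fun hv => Or.inl ⟨v, hv, rfl⟩

/-- Homomorphisms into a free amalgam can be pushed into one of its sides. -/
theorem IsFreeAmalgam.exists_hom_left (hB : IsEmb sM (canon n sB) jB)
    (hC : IsEmb sM (canon n sC) jC) (h : IsFreeAmalgam sB sC sD jB jC iB iC) [Finite Q]
    (hQ : Nat.card Q ≤ n) {sQ : L.Structure Q} {f : Q → D} (hf : IsHom sQ sD f)
    (hS : Anchored sQ {q | ∃ b, iB b = f q}) :
    ∃ g : Q → B, IsHom sQ sB g ∧ ∀ q b, iB b = f q → g q = b := by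
  let V : Set Q := {q | ∃ c, iC c = f q}
  choose fC hfC using fun q : V => q.2
  have hfC_hom : IsHom (pull sQ ((↑) : V → Q)) sC fC := by
    intro k R v hv
    have h1 := hf k R _ hv
    have h2 : f ∘ (((↑) : V → Q) ∘ v) = iC ∘ (fC ∘ v) := by
      funext i
      exact (hfC _).symm
    rw [h2] at h1
    exact (h.symm.rel_left hC hB R _).1 h1
  -- A tuple meeting a closed `T ⊆ V` that avoids the preimage of `B` must come from `C`. So `T` is
  -- closed in all of `Q`, and `hS` contradicts the avoidance.
  have hanch : Anchored (pull sQ ((↑) : V → Q)) {q : V | ∃ b, iB b = f q} := by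
    rintro T hT hc
    by_contra hTS
    have hTS' : ∀ q : V, q ∈ T → ¬ ∃ b, iB b = f q := fun q hq hb => hTS ⟨q, hq, hb⟩
    obtain ⟨q, ⟨q', hq', rfl⟩, hb⟩ := hS ((↑) '' T) (hT.image _) (by
      intro k R v hv i j
      rintro ⟨q, hq, hqi⟩
      rcases (h.rel k R _).1 (hf k R v hv) with ⟨w, -, hw⟩ | ⟨w, -, hw⟩
      · exact absurd ⟨w i, by rw [hqi]; exact congrFun hw i⟩ (hTS' q hq)
      · have hV : ∀ i, v i ∈ V := fun i => ⟨w i, congrFun hw i⟩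
        refine ⟨⟨v j, hV j⟩, hc k R (fun i => ⟨v i, hV i⟩) hv i j ?_, rfl⟩
        convert hq
        exact hqi.symm)
    exact hTS' q' hq' hb
  choose b hb using fun q : {q : V | ∃ b, iB b = f q} => q.2
  choose m hm hm' using fun q : {q : V | ∃ b, iB b = f q} =>
    h.meet (b q) (fC q) ((hb q).trans (hfC q).symm)
  obtain ⟨gC, hgC, hgCm⟩ := exists_hom_of_isEmb_canon hB hC
    ((Nat.card_le_card_of_injective _ Subtype.val_injective).trans hQ) hanch hfC_hom m hm'
  have hgCb : ∀ (q : V) b, iB b = f q → gC q = b := by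
    intro q b' hb'
    have h1 := hgCm ⟨q, b', hb'⟩
    rw [← hm] at h1
    rw [h1]
    exact h.injB ((hb _).trans hb'.symm)
  -- The glued map is `gC` on `V` and `f` read in `B` elsewhere; by `hgCb` it fixes every vertex
  -- already over `B`.
  have hex : ∀ q, ∃ b, (∀ b', iB b' = f q → b = b') ∧ ∀ hq : q ∈ V, b = gC ⟨q, hq⟩ := by
    intro q
    by_cases hq : q ∈ V
    · exact ⟨gC ⟨q, hq⟩, hgCb ⟨q, hq⟩, fun _ => rfl⟩
    · rcases h.cover (f q) with ⟨b, hb⟩ | hc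
      · exact ⟨b, fun b' hb' => h.injB (hb.trans hb'.symm), fun hq' => absurd hq' hq⟩
      · exact absurd hc hq
  choose g hg hg' using hex
  refine ⟨g, fun k R v hv => ?_, hg⟩
  rcases (h.rel k R _).1 (hf k R v hv) with ⟨w, hw, hwv⟩ | ⟨w, -, hw⟩
  · convert hw using 1
    exact funext fun i => hg _ _ (congrFun hwv i)
  · have hV : ∀ i, v i ∈ V := fun i => ⟨w i, congrFun hw i⟩
    have h1 := hgC k R (fun i => ⟨v i, hV i⟩) hv
    convert h1 using 1
    exact funext fun i => hg' _ (hV i)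

/-- The canonical lift of one side of a free amalgam is a substructure of the canonical lift of the
amalgam. -/
theorem IsFreeAmalgam.isEmb_left (hB : IsEmb sM (canon n sB) jB) (hC : IsEmb sM (canon n sC) jC)
    (h : IsFreeAmalgam sB sC sD jB jC iB iC) : IsEmb (canon n sB) (canon n sD) iB := by
  refine isEmb_canon_iff.2 ⟨h.injB, fun k R v => (h.rel_left hB hC R v).symm, fun k P v => ?_⟩
  constructor
  · rintro ⟨g, hg, rfl⟩
    exact ⟨iB ∘ g, fun k R v hv => (h.rel_left hB hC R _).2 (hg k R v hv), rfl⟩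
  · rintro ⟨f, hf, hfv⟩
    -- The roots lie over `B` and anchor the piece, so the piece moves into `B` with its roots
    -- fixed.
    obtain ⟨g, hg, hgb⟩ := h.exists_hom_left hB hC
      (by simpa using Nat.le_of_lt_succ P.size.2) hf (P.anchored.mono (by
        rintro _ ⟨i, rfl⟩
        exact ⟨v i, (congrFun hfv i).symm⟩))
    exact ⟨g, hg, funext fun i => hgb _ _ (congrFun hfv i).symm⟩

end Amalgam

/-- No member of `F` maps homomorphically to the structure. -/
def Omits (F : Set (Bundled.{0} L.Structure)) (sB : L.Structure B) : Prop :=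
  ∀ A ∈ F, ∀ f : A → B, ¬ IsHom A.str sB f

/-- If the image of a connected structure meets `B`, the map can be pushed into `B`; otherwise it
lies entirely in `C`. -/
theorem IsFreeAmalgam.omits {n : ℕ} {sM : (L.sum (pieceLang L n)).Structure M}
    {sB : L.Structure B} {sC : L.Structure C} {sD : L.Structure D} {jB : M → B} {jC : M → C}
    {iB : B → D} {iC : C → D} (hB : IsEmb sM (canon n sB) jB) (hC : IsEmb sM (canon n sC) jC)
    (h : IsFreeAmalgam sB sC sD jB jC iB iC) {F : Set (Bundled.{0} L.Structure)}
    (hfin : ∀ A ∈ F, Finite A) (hconn : ∀ A ∈ F, IsConnected A) (hn : ∀ A ∈ F, Nat.card A ≤ n)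
    (hFB : Omits F sB) (hFC : Omits F sC) : Omits F sD := by
  intro A hA f hf
  have := hfin A hA
  by_cases hne : {q | ∃ b, iB b = f q}.Nonempty
  · obtain ⟨g, hg, -⟩ := h.exists_hom_left hB hC (hn A hA) hf
      (anchored_of_isConnected (hconn A hA) hne)
    exact hFB A hA g hg
  · have hcov : ∀ q, ∃ c, iC c = f q := fun q =>
      (h.cover (f q)).resolve_left fun hb => hne ⟨q, hb⟩
    choose g hg using hcov
    refine hFC A hA g fun k R v hv => (h.symm.rel_left hC hB R _).1 ?_
    convert hf k R v hv using 1
    exact funext fun i => hg _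

/-! ### The lift class and its amalgamation -/

/-- The substructures of canonical lifts of countable structures omitting `F`. -/
def liftClass (F : Set (Bundled.{0} L.Structure)) (n : ℕ) :
    Set (Bundled.{0} (L.sum (pieceLang L n)).Structure) :=
  {X | ∃ (B : Type) (sB : L.Structure B) (e : X → B), Countable B ∧ Omits F sB ∧
    IsEmb X.str (canon n sB) e}

theorem mem_liftClass_of_isEmb {F : Set (Bundled.{0} L.Structure)} {n : ℕ}
    {X Y : Bundled.{0} (L.sum (pieceLang L n)).Structure} (hX : X ∈ liftClass F n) {f : Y → X}
    (hf : IsEmb Y.str X.str f) : Y ∈ liftClass F n := by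
  obtain ⟨B, sB, e, hB, hF, he⟩ := hX
  exact ⟨B, sB, e ∘ f, hB, hF, he.comp hf⟩

theorem countable_of_mem_liftClass {F : Set (Bundled.{0} L.Structure)} {n : ℕ}
    {X : Bundled.{0} (L.sum (pieceLang L n)).Structure} (hX : X ∈ liftClass F n) :
    Countable X := by
  obtain ⟨B, sB, e, hB, hF, he⟩ := hX
  exact he.inj.countable

/-- The free amalgam is formed from the ambient structures `B` and `C` rather than from `Y` and `Z`:
only there do the piece relations have witnesses. -/
theorem amalgamation_liftClass {F : Set (Bundled.{0} L.Structure)} {n : ℕ}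
    (hfin : ∀ A ∈ F, Finite A) (hconn : ∀ A ∈ F, IsConnected A)
    (hn : ∀ A ∈ F, Nat.card A ≤ n) : Amalgamation (liftClass F n) := by
  rintro X Y Z u v hX ⟨B, sB, eB, hcB, hFB, hB⟩ ⟨C, sC, eC, hcC, hFC, hC⟩
  have hB' := hB.comp (isEmb_coe u)
  have hC' := hC.comp (isEmb_coe v)
  obtain ⟨D, sD, iB, iC, hcD, hD⟩ := exists_isFreeAmalgam sB sC hB'.inj hC'.inj
  have hiB := (hD.isEmb_left hB' hC').comp hB
  have hiC := (hD.symm.isEmb_left hC' hB').comp hC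
  refine ⟨⟨D, canon n sD⟩, hiB.toEmbedding, hiC.toEmbedding,
    ⟨D, sD, id, hcD, hD.omits hB' hC' hfin hconn hn hFB hFC, IsEmb.id _⟩, ?_⟩
  exact DFunLike.ext _ _ fun x => hD.comm x

end Pieces

/-! ### Membership in the lift class is a local condition -/

section Locality

variable {L : FirstOrder.Language.{0, 0}} {Q X : Type} {n : ℕ}

/-- The instances of rooted structures holding in a lift. -/
structure Attachment (sX : (L.sum (pieceLang L n)).Structure X) where
  arity : ℕ
  piece : PieceRel L n arity
  tuple : Fin arity → X
  holds : sX.RelMap (Sum.inr piece : _ ⊕ (pieceLang L n).Relations arity) tuple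

theorem countable_attachment [Finite (Σ k, (pieceLang L n).Relations k)] [Countable X]
    (sX : (L.sum (pieceLang L n)).Structure X) : Countable (Attachment sX) := by
  refine Function.Injective.countable
    (β := Σ x : (Σ k, (pieceLang L n).Relations k), Fin x.1 → X)
    (f := fun i => ⟨⟨i.arity, i.piece⟩, i.tuple⟩) ?_
  rintro ⟨⟩ ⟨⟩ h
  cases h
  rfl

variable (sX : (L.sum (pieceLang L n)).Structure X)

/-- The vertices of a lift together with the non-root vertices of a fresh copy of every rooted
structure holding in it. -/
abbrev Completion : Type :=
  X ⊕ Σ i : Attachment sX, {x : Fin i.piece.size // ¬ ∃ j, i.piece.root j = x}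

variable {sX}

open Classical in
/-- The canonical map from a rooted structure to the completion. -/
noncomputable def attach (i : Attachment sX) (x : Fin i.piece.size) : Completion sX :=
  if h : ∃ j, i.piece.root j = x then Sum.inl (i.tuple h.choose) else Sum.inr ⟨i, x, h⟩

theorem attach_root (i : Attachment sX) (j : Fin i.arity) :
    attach i (i.piece.root j) = Sum.inl (i.tuple j) := by
  have h : ∃ j', i.piece.root j' = i.piece.root j := ⟨j, rfl⟩
  rw [attach, dif_pos h, i.piece.inj h.choose_spec]

theorem attach_of_not {i : Attachment sX} {x : Fin i.piece.size}
    (h : ¬ ∃ j, i.piece.root j = x) : attach i x = Sum.inr ⟨i, x, h⟩ := dif_neg h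

variable [L.IsRelational]

variable (sX) in
/-- The completion of a lift, obtained by freely gluing the rooted structures to it. -/
@[reducible]
noncomputable def completion : L.Structure (Completion sX) :=
  ofRel fun k R v =>
    (∃ w : Fin k → X, sX.RelMap (Sum.inl R : _ ⊕ (pieceLang L n).Relations k) w ∧
      Sum.inl ∘ w = v) ∨
    ∃ (i : Attachment sX) (w : Fin k → Fin i.piece.size), i.piece.str.RelMap R w ∧
      attach i ∘ w = v

/-- Every induced substructure with at most `N` vertices belongs to the lift class. -/
def LocallyLift (F : Set (Bundled.{0} L.Structure)) (N : ℕ)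
    (sX : (L.sum (pieceLang L n)).Structure X) : Prop :=
  ∀ S : Finset X, S.card ≤ N →
    (⟨S, pull sX ((↑) : S → X)⟩ : Bundled.{0} (L.sum (pieceLang L n)).Structure) ∈ liftClass F n

theorem exists_hom_of_attachment {S : Finset X} {B : Type} {sB : L.Structure B} {e : S → B}
    (he : IsEmb (pull sX ((↑) : S → X)) (canon n sB) e) (i : Attachment sX)
    (hi : ∀ j, i.tuple j ∈ S) :
    ∃ h : Fin i.piece.size → B, IsHom i.piece.str sB h ∧
      ∀ j, h (i.piece.root j) = e ⟨i.tuple j, hi j⟩ := by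
  obtain ⟨h, hh, hr⟩ := ((isEmb_canon_iff.1 he).2.2 _ i.piece (fun j => ⟨i.tuple j, hi j⟩)).1
    i.holds
  exact ⟨h, hh, congrFun hr⟩

/-- A tuple of old vertices coming from a glued copy consists of roots. Mapping the piece to a
witness for its at most `n` roots shows that the relation already held in the lift. -/
theorem completion_rel_inl {F : Set (Bundled.{0} L.Structure)} (hloc : LocallyLift F n sX) {k : ℕ}
    (R : L.Relations k) (v : Fin k → X) :
    (completion sX).RelMap R (Sum.inl ∘ v) ↔
      sX.RelMap (Sum.inl R : _ ⊕ (pieceLang L n).Relations k) v := by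
  classical
  constructor
  · rintro (⟨w, hw, hwv⟩ | ⟨i, w, hw, hwv⟩)
    · rwa [← Sum.inl_injective.comp_left hwv]
    · have hroot : ∀ j, ∃ t, i.piece.root t = w j := fun j => by
        by_contra hj
        have := congrFun hwv j
        simp [attach_of_not hj] at this
      choose t ht using hroot
      have hv : ∀ j, v j = i.tuple (t j) := fun j => by
        have := congrFun hwv j
        simp only [Function.comp_apply, ← ht, attach_root] at this
        exact (Sum.inl_injective this).symm
      let S : Finset X := Finset.univ.image i.tuple
      have hS : S.card ≤ n :=
        (Finset.card_image_le.trans (by simp)).trans i.piece.arity_le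
      have hi : ∀ j, i.tuple j ∈ S := fun j => Finset.mem_image_of_mem _ (Finset.mem_univ j)
      obtain ⟨B, sB, e, -, -, he⟩ := hloc S hS
      obtain ⟨h, hh, hr⟩ := exists_hom_of_attachment he i hi
      have h1 := hh k R w hw
      have h2 : h ∘ w = e ∘ fun j => ⟨i.tuple (t j), hi (t j)⟩ := by
        funext j
        simp only [Function.comp_apply, ← ht, hr]
      rw [h2] at h1
      have h3 := ((isEmb_canon_iff.1 he).2.1 k R _).2 h1
      rw [funext hv]
      exact h3
  · exact fun h => Or.inl ⟨v, h, rfl⟩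

/-- Serves both to exclude members of `F` from the completion and to show that no piece newly holds
on old vertices: small maps into the completion transfer to a witness for finitely many old
vertices. -/
theorem exists_retraction {F : Set (Bundled.{0} L.Structure)} (hn : 0 < n)
    (hloc : LocallyLift F (n * n) sX) [Finite Q] (hQ : Nat.card Q ≤ n) {sQ : L.Structure Q}
    {f : Q → Completion sX} (hf : IsHom sQ (completion sX) f) :
    ∃ (S : Finset X) (B : Type) (sB : L.Structure B) (e : S → B), Omits F sB ∧
      IsEmb (pull sX ((↑) : S → X)) (canon n sB) e ∧
      ∃ g : Q → B, IsHom sQ sB g ∧ ∀ q x, f q = Sum.inl x → ∃ hx : x ∈ S, g q = e ⟨x, hx⟩ := by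
  classical
  have := Fintype.ofFinite Q
  have hloc' : LocallyLift F n sX := fun S hS => hloc S (hS.trans (Nat.le_mul_self n))
  -- An old vertex is supported by itself, a new vertex by the roots of its copy. Each support has
  -- at most `n` elements (here `0 < n` matters), giving `n * n` in total.
  let supp : Completion sX → Finset X :=
    Sum.elim (fun x => {x}) fun y => Finset.univ.image y.1.tuple
  have hsupp : ∀ y, (supp y).card ≤ n := by
    rintro (x | ⟨i, x⟩)
    · simpa [supp] using Nat.succ_le_of_lt hn
    · exact (Finset.card_image_le.trans (by simp)).trans i.piece.arity_le
  let S : Finset X := Finset.univ.biUnion fun q => supp (f q)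
  have hS : S.card ≤ n * n := by
    refine (Finset.card_biUnion_le_card_mul _ _ n fun q _ => hsupp _).trans ?_
    rw [Finset.card_univ, ← Nat.card_eq_fintype_card]
    exact Nat.mul_le_mul_right n hQ
  have hSq : ∀ q x, x ∈ supp (f q) → x ∈ S := fun q x hx =>
    Finset.mem_biUnion.2 ⟨q, Finset.mem_univ q, hx⟩
  have hSx : ∀ q x, f q = Sum.inl x → x ∈ S := fun q x hx => hSq q x (by simp [hx, supp])
  have hSi : ∀ q i y, f q = Sum.inr ⟨i, y⟩ → ∀ j, i.tuple j ∈ S := fun q i y hy j =>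
    hSq q _ (by simp [hy, supp])
  obtain ⟨B, sB, e, -, hFB, he⟩ := hloc S hS
  refine ⟨S, B, sB, e, hFB, he, ?_⟩
  -- One homomorphism is fixed per copy, so all vertices of `Q` landing in the same copy are moved
  -- consistently.
  choose h hh hr using exists_hom_of_attachment he
  have hex : ∀ q, ∃ b, (∀ x (hx : x ∈ S), f q = Sum.inl x → b = e ⟨x, hx⟩) ∧
      ∀ i (hi : ∀ j, i.tuple j ∈ S) y, f q = Sum.inr ⟨i, y⟩ → b = h i hi y := by
    intro q
    rcases hq : f q with x | ⟨i, y⟩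
    · refine ⟨e ⟨x, hSx q x hq⟩, ?_, by simp⟩
      intro x' hx' h
      cases h
      rfl
    · refine ⟨h i (hSi q i y hq) y, by simp, ?_⟩
      intro i' hi' y' h
      cases h
      rfl
  choose g hg hg' using hex
  have hcase : ∀ {k : ℕ} (R : L.Relations k) (v : Fin k → Q) (w : Fin k → X),
      sX.RelMap (Sum.inl R : _ ⊕ (pieceLang L n).Relations k) w → Sum.inl ∘ w = f ∘ v →
      sB.RelMap R (g ∘ v) := by
    intro k R v w hw hwv
    have hwS : ∀ j, w j ∈ S := fun j => hSx _ _ (congrFun hwv j).symm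
    have h1 : g ∘ v = e ∘ fun j => ⟨w j, hwS j⟩ :=
      funext fun j => hg _ _ _ (congrFun hwv j).symm
    rw [h1]
    exact ((isEmb_canon_iff.1 he).2.1 k R _).1 hw
  refine ⟨g, fun k R v hv => ?_, fun q x hx => ⟨hSx q x hx, hg q x _ hx⟩⟩
  rcases hf k R v hv with ⟨w, hw, hwv⟩ | ⟨i, w, hw, hwv⟩
  · exact hcase R v w hw hwv
  -- A tuple of roots only is a relation of the lift itself, and the other roots of its copy may lie
  -- outside `S`. A non-root vertex in the tuple puts all roots of its copy into `S`.
  · by_cases hall : ∀ j, ∃ t, i.piece.root t = w j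
    · choose t ht using hall
      have h1 : Sum.inl ∘ (i.tuple ∘ t) = f ∘ v := by
        rw [← hwv]
        funext j
        simp [← ht, attach_root]
      refine hcase R v (i.tuple ∘ t) ((completion_rel_inl hloc' R _).1 ?_) h1
      rw [h1]
      exact hf k R v hv
    · push Not at hall
      obtain ⟨j₀, hj₀⟩ := hall
      have hi : ∀ j, i.tuple j ∈ S := hSi (v j₀) i ⟨w j₀, by simpa using hj₀⟩
        ((congrFun hwv j₀).symm.trans (attach_of_not (by simpa using hj₀)))
      have h1 : g ∘ v = h i hi ∘ w := by
        funext j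
        have h2 : f (v j) = attach i (w j) := (congrFun hwv j).symm
        by_cases hj : ∃ t, i.piece.root t = w j
        · obtain ⟨t, ht⟩ := hj
          rw [← ht, attach_root] at h2
          rw [Function.comp_apply, Function.comp_apply, ← ht, hr, hg _ _ (hi t) h2]
        · rw [attach_of_not hj] at h2
          exact hg' _ _ hi _ h2
      rw [h1]
      exact hh i hi k R w hw

/-- Membership in the lift class is determined by the substructures of bounded size. -/
theorem mem_liftClass_of_locallyLift {F : Set (Bundled.{0} L.Structure)} (hn : 0 < n)
    [Finite (Σ k, (pieceLang L n).Relations k)] [Countable X]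
    (hfin : ∀ A ∈ F, Finite A) (hcard : ∀ A ∈ F, Nat.card A ≤ n)
    (hloc : LocallyLift F (n * n) sX) :
    (⟨X, sX⟩ : Bundled.{0} (L.sum (pieceLang L n)).Structure) ∈ liftClass F n := by
  have hloc' : LocallyLift F n sX := fun S hS => hloc S (hS.trans (Nat.le_mul_self n))
  have := countable_attachment sX
  refine ⟨Completion sX, completion sX, Sum.inl, inferInstance, ?_, ?_⟩
  · intro A hA f hf
    have := hfin A hA
    obtain ⟨S, B, sB, e, hFB, -, g, hg, -⟩ := exists_retraction hn hloc (hcard A hA) hf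
    exact hFB A hA g hg
  · refine isEmb_canon_iff.2 ⟨Sum.inl_injective,
      fun k R v => (completion_rel_inl hloc' R v).symm, fun k P v => ⟨fun h => ?_, ?_⟩⟩
    · exact ⟨attach ⟨k, P, v, h⟩, fun l R w hw => Or.inr ⟨⟨k, P, v, h⟩, w, hw, rfl⟩,
        funext fun j => attach_root ⟨k, P, v, h⟩ j⟩
    -- A piece mapped into the completion with old roots retracts to a witness for `S`, so it
    -- already holds in the lift.
    · rintro ⟨f, hf, hfv⟩
      obtain ⟨S, B, sB, e, -, he, g, hg, hgx⟩ := exists_retraction hn hloc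
        (by simpa using Nat.le_of_lt_succ P.size.2) hf
      choose hx hge using fun j => hgx (P.root j) (v j) (congrFun hfv j)
      exact ((isEmb_canon_iff.1 he).2.2 k P fun j => ⟨v j, hx j⟩).2 ⟨g, hg, funext hge⟩

/-! ### The finite set of obstructions and the shadows -/

variable (F : Set (Bundled.{0} L.Structure)) (n N : ℕ)

/-- The structures on initial segments of `ℕ` with at most `N` elements outside the lift class. -/
def obstructions : Set (Bundled.{0} (L.sum (pieceLang L n)).Structure) :=
  {X | ∃ (m : Fin (N + 1)) (s : (L.sum (pieceLang L n)).Structure (Fin m)), ⟨Fin m, s⟩ = X} \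
    liftClass F n

theorem finite_sum_relations {L E : FirstOrder.Language.{0, 0}} [Finite (Σ k, L.Relations k)]
    [Finite (Σ k, E.Relations k)] : Finite (Σ k, (L.sum E).Relations k) :=
  Finite.of_equiv _ (Equiv.sigmaSumDistrib L.Relations E.Relations).symm

theorem finite_obstructions [Finite (Σ k, L.Relations k)]
    [Finite (Σ k, (pieceLang L n).Relations k)] : (obstructions F n N).Finite := by
  have := finite_sum_relations (L := L) (E := pieceLang L n)
  have : ∀ m : Fin (N + 1), Finite ((L.sum (pieceLang L n)).Structure (Fin m)) :=
    fun m => finite_structure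
  refine (Set.finite_range fun x : Σ m : Fin (N + 1), (L.sum (pieceLang L n)).Structure (Fin m) =>
    (⟨Fin x.1, x.2⟩ : Bundled.{0} (L.sum (pieceLang L n)).Structure)).subset ?_
  rintro X ⟨⟨m, s, rfl⟩, -⟩
  exact ⟨⟨m, s⟩, rfl⟩

variable {F n}

/-- A structure outside the hereditary lift class has an induced substructure outside it with at
most `n * n` vertices, which is isomorphic to an obstruction. -/
theorem forbE_obstructions (hn : 0 < n) [Finite (Σ k, (pieceLang L n).Relations k)]
    (hfin : ∀ A ∈ F, Finite A) (hcard : ∀ A ∈ F, Nat.card A ≤ n) :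
    ForbE (obstructions F n (n * n)) = liftClass F n := by
  ext X
  constructor
  · rintro ⟨hX, hE⟩
    refine mem_liftClass_of_locallyLift hn hfin hcard fun S hS => ?_
    by_contra hmem
    let u : Fin S.card ≃ S := S.equivFin.symm
    have hu : IsEmb (pull (pull X.str ((↑) : S → X)) u) (pull X.str ((↑) : S → X)) u :=
      isEmb_pull _ u.injective
    refine (hE ⟨Fin S.card, pull (pull X.str ((↑) : S → X)) u⟩
      ⟨⟨⟨S.card, Nat.lt_succ_of_le hS⟩, _, rfl⟩, fun hmem' => hmem ?_⟩).elim ?_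
    · exact mem_liftClass_of_isEmb hmem' hu.symm
    · exact ((isEmb_pull X.str Subtype.val_injective).comp hu).toEmbedding
  · exact fun hX => ⟨countable_of_mem_liftClass hX, fun Y hY =>
      ⟨fun f => hY.2 (mem_liftClass_of_isEmb hX (isEmb_coe f))⟩⟩

theorem omits_iff {A : Bundled.{0} L.Structure} :
    Omits F A.str ↔ ∀ B ∈ F, IsEmpty (B →[L] A) :=
  ⟨fun h B hB => ⟨fun f => h B hB f (isHom_coe f)⟩, fun h B hB _ hf => (h B hB).elim hf.toHom⟩

/-- The shadow of a lift embeds into an `F`-free structure; conversely an `F`-free structure is the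
shadow of its own canonical lift. -/
theorem shadow_liftClass : shadow '' liftClass F n = ForbH F := by
  ext A
  constructor
  · rintro ⟨X, hX, rfl⟩
    refine ⟨countable_of_mem_liftClass hX, omits_iff.1 ?_⟩
    obtain ⟨B, sB, e, -, hF, he⟩ := hX
    exact fun A hA f hf => hF A hA (e ∘ f)
      fun k R v hv => ((isEmb_canon_iff.1 he).2.1 k R _).1 (hf k R v hv)
  · rintro ⟨hA, hF⟩
    refine ⟨⟨A, canon n A.str⟩, ⟨A, A.str, id, hA, omits_iff.2 hF, IsEmb.id _⟩, ?_⟩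
    obtain ⟨A, sA⟩ := A
    exact congrArg (fun s : L.Structure A => (⟨A, s⟩ : Bundled.{0} L.Structure))
      (structure_ext fun _ _ _ => Iff.rfl)

end Locality

/-! ### Assembly of the theorem -/

theorem isAmalgamationClass_liftClass {L : FirstOrder.Language.{0, 0}} (hL : IsFiniteType L)
    [L.IsRelational] {F : Set (Bundled.{0} L.Structure)} {n : ℕ} (hfin : ∀ A ∈ F, Finite A)
    (hconn : ∀ A ∈ F, IsConnected A) (hn : ∀ A ∈ F, Nat.card A ≤ n) :
    IsAmalgamationClass (liftClass F n) where
  hereditary _ hA _ := fun ⟨f⟩ => mem_liftClass_of_isEmb hA (isEmb_coe f)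
  jointEmbedding := by
    have h0 := hL.positive
    have h0' := (isFiniteType_pieceLang hL n).positive
    exact jointEmbedding_of_amalgamation (inferInstanceAs (IsEmpty (_ ⊕ _)))
      (fun _ hA _ _ hf => mem_liftClass_of_isEmb hA hf) (amalgamation_liftClass hfin hconn hn)
  amalgamation := amalgamation_liftClass hfin hconn hn

theorem exists_card_le {L : FirstOrder.Language.{0, 0}} {F : Set (Bundled.{0} L.Structure)}
    (hF : F.Finite) : ∃ n, 0 < n ∧ ∀ A ∈ F, Nat.card A ≤ n := by
  obtain ⟨n, hn⟩ := (hF.image fun A : Bundled.{0} L.Structure => Nat.card A).bddAbove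
  -- The successor makes the bound positive even when `F` is empty.
  exact ⟨n + 1, n.succ_pos, fun A hA => (hn ⟨A, hA, rfl⟩).trans n.le_succ⟩

/-- Connected structures are nonempty, so the empty structure omits `F`. -/
theorem exists_finite_mem_liftClass {L : FirstOrder.Language.{0, 0}} [L.IsRelational]
    {F : Set (Bundled.{0} L.Structure)} (hconn : ∀ A ∈ F, IsConnected A) (n : ℕ) :
    (finitePart (liftClass F n)).Nonempty := by
  let s : L.Structure Empty := ofRel fun _ _ _ => False
  refine ⟨⟨Empty, canon n s⟩, ⟨Empty, s, id, inferInstance, fun A hA f _ => ?_, IsEmb.id _⟩,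
    inferInstanceAs (Finite Empty)⟩
  exact (f (hconn A hA).nonempty.some).elim

end RelStr

theorem mainTheorem1 (L : FirstOrder.Language.{0, 0}) (hL : RelStr.IsFiniteType L)
    (F : Set (Bundled.{0} L.Structure)) (hF : F.Finite)
    (hfin : ∀ A ∈ F, Finite A) (hconn : ∀ A ∈ F, RelStr.IsConnected A) :
    ∃ (E : FirstOrder.Language.{0, 0}) (F' : Set (Bundled.{0} (L.sum E).Structure)),
      RelStr.IsFiniteType E ∧ F'.Finite ∧ (∀ X ∈ F', Finite X) ∧
      (RelStr.IsAmalgamationClass (RelStr.ForbE F') ∧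
        FirstOrder.Language.IsFraisse (RelStr.finitePart (RelStr.ForbE F')) ∧
        RelStr.shadow '' RelStr.ForbE F' = RelStr.ForbH F) ∧
      (∃ U, RelStr.IsLimit (RelStr.finitePart (RelStr.ForbE F')) U) ∧
      (∀ U, RelStr.IsLimit (RelStr.finitePart (RelStr.ForbE F')) U →
        RelStr.IsGeneric (RelStr.ForbE F') U ∧
        RelStr.IsUniversal (RelStr.ForbH F) (RelStr.shadow U)) := by
  have := hL.relational
  have := hL.finite
  obtain ⟨n, hn, hcard⟩ := RelStr.exists_card_le hF
  have hE := RelStr.isFiniteType_pieceLang hL n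
  have := hE.finite
  have := RelStr.finite_sum_relations (L := L) (E := RelStr.pieceLang L n)
  have h0 : IsEmpty ((L.sum (RelStr.pieceLang L n)).Relations 0) := by
    have := hL.positive
    have := hE.positive
    exact inferInstanceAs (IsEmpty (_ ⊕ _))
  have hforb := RelStr.forbE_obstructions hn hfin hcard
  have hclass := RelStr.isAmalgamationClass_liftClass hL hfin hconn hcard
  have hemb : RelStr.ClosedUnderEmb (RelStr.liftClass F n) :=
    fun _ hA _ _ hf => RelStr.mem_liftClass_of_isEmb hA hf
  have hobs : ∀ X ∈ RelStr.obstructions F n (n * n), Finite X := by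
    rintro _ ⟨⟨m, s, rfl⟩, -⟩
    exact inferInstanceAs (Finite (Fin m))
  have hlim : ∃ U, RelStr.IsLimit (RelStr.finitePart (RelStr.liftClass F n)) U :=
    RelStr.exists_isLimit h0
      (fun A hA B f hf => ⟨hemb A hA.1 B f hf, @Finite.of_injective _ _ hA.2 f hf.inj⟩)
      (fun _ hA => hA.2) (RelStr.amalgamation_finitePart hemb hclass.amalgamation)
      (RelStr.exists_finite_mem_liftClass hconn n)
  refine ⟨RelStr.pieceLang L n, RelStr.obstructions F n (n * n), hE,
    RelStr.finite_obstructions F n (n * n), hobs, ?_, ?_, ?_⟩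
  · rw [hforb]
    refine ⟨hclass, ?_, RelStr.shadow_liftClass⟩
    obtain ⟨U, _, _, hU⟩ := hlim
    exact hU.isFraisse
  · rw [hforb]
    exact hlim
  · intro U hU
    have hUF := RelStr.mem_forbE_of_isLimit hobs hU
    rw [hforb] at hU hUF ⊢
    have huniv : ∀ A ∈ RelStr.liftClass F n,
        Nonempty (A ↪[L.sum (RelStr.pieceLang L n)] U) := fun A hA =>
      have := RelStr.countable_of_mem_liftClass hA
      RelStr.nonempty_embedding_of_isLimit h0 hemb hU hA
    refine ⟨⟨⟨hUF, huniv⟩, ?_⟩, ?_, ?_⟩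
    · obtain ⟨_, _, hU⟩ := hU
      exact hU.ultrahomogeneous
    · rw [← RelStr.shadow_liftClass (n := n)]
      exact ⟨U, hUF, rfl⟩
    · intro A hA
      -- Lift `A`, embed the lift into `U`, and forget the piece relations.
      rw [← RelStr.shadow_liftClass (n := n)] at hA
      obtain ⟨X, hX, rfl⟩ := hA
      obtain ⟨f⟩ := huniv X hX
      have hf : RelStr.IsEmb (RelStr.shadow X).str (RelStr.shadow U).str f :=
        ⟨f.injective, fun k R v => (RelStr.isEmb_coe f).rel k (Sum.inl R) v⟩
      exact ⟨hf.toEmbedding⟩
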